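/- Let $L$ be a frame with bottom $0$, top $1$ and pseudocomplements $x^*$. Assume that $L$ is zero-dimensional, i.e. $a=\bigvee\{x\in L : x\vee x^*=1,\ x\le a\}$ for every $a\in L$. Let $\mathcal{R}L$ be the commutative ring of frame homomorphisms $\alpha:\mathfrak{O}\mathbb{R}\to L$ from the frame of reals, with operations $(\alpha\diamond\beta)(U)=\bigvee\{\alpha(V)\wedge\beta(W) : V\diamond W\subseteq U\}$ for $\diamond\in\{+,\cdot\}$, where $U,V,W$ are open in $\mathbb{R}$ and $V\diamond W=\{v\diamond w : v\in V,\ w\in W\}$. For $r\in\mathbb{R}$ let $\mathbf{r}\in\mathcal{R}L$ be the constant function ($\mathbf{r}(U)=1$ if $r\in U$, and $0$ otherwise). Put $\operatorname{coz}\alpha=\alpha((-\infty,0))\vee\alpha((0,\infty))$ and $R_\alpha=\{r\in\mathbb{R} : \operatorname{coz}(\alpha-\mathbf{r})\neq 1\}$. Let $\mathcal{R}_cL$ be the subring of $\mathcal{R}L$ generated by the set $\{\alpha\in\mathcal{R}L : R_\alpha\text{ is countable}\}$ (it equals this set whenever the set is a subring). An ideal $Q$ of $\mathcal{R}_cL$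 is called fixed if $\bigvee_{\alpha\in Q}\operatorname{coz}\alpha<1$. A point of $L$ is an element $p\neq 1$ such that $a\wedge b\le p$ implies $a\le p$ or $b\le p$. For a point $p$ put $\mathbf{M}_{cp}=\{\alpha\in\mathcal{R}_cL : \operatorname{coz}\alpha\le p\}$, which is an ideal of $\mathcal{R}_cL$. Then the fixed maximal ideals of $\mathcal{R}_cL$ are precisely the ideals $\mathbf{M}_{cp}$ with $p$ a point of $L$; and if $p\neq q$ are points of $L$, then $\mathbf{M}_{cp}\neq\mathbf{M}_{cq}$. -/

import Mathlib

namespace PointfreeReals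

open TopologicalSpace Set

/-! ### Copairing of frame homomorphisms on frames of open sets -/

section Copairing

variable {X Y L : Type*} [PseudoMetricSpace X] [PseudoMetricSpace Y] [Order.Frame L]

/-- The join of all `f V ⊓ g W` over the open boxes `V × W` contained in `O`. -/
def boxJoin (f : FrameHom (Opens X) L) (g : FrameHom (Opens Y) L) (O : Opens (X × Y)) : L :=
  ⨆ (V : Opens X) (W : Opens Y) (_ : (V : Set X) ×ˢ (W : Set Y) ⊆ (O : Set (X × Y))), f V ⊓ g W

theorem le_boxJoin (f : FrameHom (Opens X) L) (g : FrameHom (Opens Y) L) {O : Opens (X × Y)}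
    {V : Opens X} {W : Opens Y} (h : (V : Set X) ×ˢ (W : Set Y) ⊆ (O : Set (X × Y))) :
    f V ⊓ g W ≤ boxJoin f g O :=
  le_iSup_of_le V (le_iSup_of_le W (le_iSup_of_le h le_rfl))

theorem boxJoin_le (f : FrameHom (Opens X) L) (g : FrameHom (Opens Y) L) {O : Opens (X × Y)}
    {a : L} (h : ∀ (V : Opens X) (W : Opens Y),
      (V : Set X) ×ˢ (W : Set Y) ⊆ (O : Set (X × Y)) → f V ⊓ g W ≤ a) :
    boxJoin f g O ≤ a :=
  iSup_le fun V => iSup_le fun W => iSup_le fun hVW => h V W hVW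

theorem boxJoin_mono (f : FrameHom (Opens X) L) (g : FrameHom (Opens Y) L)
    {O O' : Opens (X × Y)} (h : O ≤ O') : boxJoin f g O ≤ boxJoin f g O' :=
  boxJoin_le f g fun _ _ hVW => le_boxJoin f g (hVW.trans h)

theorem map_le_iSup {Z ι : Type*} [TopologicalSpace Z] (f : FrameHom (Opens Z) L) {U : Opens Z}
    {c : ι → Opens Z} (h : ∀ x ∈ U, ∃ i, x ∈ c i) : f U ≤ ⨆ i, f (c i) := by
  rw [← map_iSup]
  refine OrderHomClass.mono f fun x hx => ?_
  obtain ⟨i, hi⟩ := h x hx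
  exact Opens.mem_iSup.2 ⟨i, hi⟩

theorem inf_le_of_isCompact (f : FrameHom (Opens X) L) (g : FrameHom (Opens Y) L)
    (S : Set (Opens (X × Y))) {K : Set X} {K' : Set Y} (hK : IsCompact K) (hK' : IsCompact K')
    (hS : K ×ˢ K' ⊆ ⋃ O : S, ((O : Opens (X × Y)) : Set (X × Y))) {V : Opens X} {W : Opens Y}
    (hV : (V : Set X) ⊆ K) (hW : (W : Set Y) ⊆ K') :
    f V ⊓ g W ≤ ⨆ O : S, boxJoin f g O := by
  obtain ⟨δ, hδ, h⟩ := lebesgue_number_lemma_of_metric (hK.prod hK')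
    (fun O : S => (O : Opens (X × Y)).isOpen) hS
  have h1 : f V ≤ ⨆ x : K, f ⟨Metric.ball (x : X) δ, Metric.isOpen_ball⟩ :=
    map_le_iSup f fun x hx => ⟨⟨x, hV hx⟩, Metric.mem_ball_self hδ⟩
  have h2 : g W ≤ ⨆ y : K', g ⟨Metric.ball (y : Y) δ, Metric.isOpen_ball⟩ :=
    map_le_iSup g fun y hy => ⟨⟨y, hW hy⟩, Metric.mem_ball_self hδ⟩
  refine (inf_le_inf h1 h2).trans ?_
  rw [iSup_inf_iSup]
  refine iSup_le fun p => ?_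
  obtain ⟨O, hO⟩ := h (p.1, p.2) ⟨p.1.2, p.2.2⟩
  refine le_iSup_of_le O (le_boxJoin f g ?_)
  simpa [ball_prod_same] using hO

variable [LocallyCompactSpace X] [LocallyCompactSpace Y]

/-- The frame of opens of `X × Y` is the coproduct of the frames of opens of `X` and of `Y`
(for locally compact `X`, `Y`): the frame homomorphism induced by `f` and `g`. -/
def copair (f : FrameHom (Opens X) L) (g : FrameHom (Opens Y) L) :
    FrameHom (Opens (X × Y)) L where
  toFun := boxJoin f g
  map_top' := top_le_iff.1 <| by
    have := le_boxJoin f g (O := ⊤) (V := ⊤) (W := ⊤) (fun _ _ => trivial)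
    simpa using this
  map_inf' O O' := by
    refine le_antisymm (le_inf (boxJoin_mono f g inf_le_left) (boxJoin_mono f g inf_le_right)) ?_
    rw [← le_himp_iff]
    refine boxJoin_le f g fun V W h => ?_
    rw [le_himp_iff, inf_comm, ← le_himp_iff]
    refine boxJoin_le f g fun V' W' h' => ?_
    rw [le_himp_iff, inf_inf_inf_comm, ← map_inf, ← map_inf]
    refine le_boxJoin f g ?_
    rintro ⟨x, y⟩ ⟨hx, hy⟩
    exact ⟨h ⟨hx.2, hy.2⟩, h' ⟨hx.1, hy.1⟩⟩
  map_sSup' S := by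
    rw [sSup_image']
    refine le_antisymm (boxJoin_le f g fun V W h => ?_)
      (iSup_le fun O => boxJoin_mono f g (le_sSup O.2))
    have hV : f V ≤ ⨆ K : {K : Set X // IsCompact K ∧ K ⊆ V},
        f ⟨interior K, isOpen_interior⟩ := map_le_iSup f fun x hx => by
      obtain ⟨K, hK, hx, hKV⟩ := exists_compact_subset V.isOpen hx
      exact ⟨⟨K, hK, hKV⟩, hx⟩
    have hW : g W ≤ ⨆ K : {K : Set Y // IsCompact K ∧ K ⊆ W},
        g ⟨interior K, isOpen_interior⟩ := map_le_iSup g fun x hx => by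
      obtain ⟨K, hK, hx, hKV⟩ := exists_compact_subset W.isOpen hx
      exact ⟨⟨K, hK, hKV⟩, hx⟩
    refine (inf_le_inf hV hW).trans ?_
    rw [iSup_inf_iSup]
    refine iSup_le fun p => ?_
    refine inf_le_of_isCompact f g S p.1.2.1 p.2.2.1 ?_ interior_subset interior_subset
    refine (prod_mono p.1.2.2 p.2.2.2).trans (h.trans ?_)
    rw [Opens.coe_sSup, biUnion_eq_iUnion]

theorem copair_comap {Z : Type*} [TopologicalSpace Z] (T : FrameHom (Opens Z) L) (u : C(Z, X))
    (v : C(Z, Y)) :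
    copair (T.comp (Opens.comap u)) (T.comp (Opens.comap v)) =
      T.comp (Opens.comap (u.prodMk v)) := by
  refine FrameHom.ext fun O => le_antisymm ?_ ?_
  · refine boxJoin_le _ _ fun V W h => ?_
    change T (Opens.comap u V) ⊓ T (Opens.comap v W) ≤ _
    rw [← map_inf]
    exact OrderHomClass.mono T fun z hz => h ⟨hz.1, hz.2⟩
  · let B := {p : Opens X × Opens Y // (p.1 : Set X) ×ˢ (p.2 : Set Y) ⊆ (O : Set (X × Y))}
    have key : T (Opens.comap (u.prodMk v) O) ≤
        ⨆ p : B, T (Opens.comap u p.1.1 ⊓ Opens.comap v p.1.2) := map_le_iSup T fun z hz => by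
      obtain ⟨V, W, hV, hW, hx, hy, h⟩ := isOpen_prod_iff.1 O.isOpen (u z) (v z) hz
      exact ⟨⟨(⟨V, hV⟩, ⟨W, hW⟩), h⟩, hx, hy⟩
    refine key.trans (iSup_le fun p => ?_)
    rw [map_inf]
    exact le_boxJoin (T.comp (Opens.comap u)) (T.comp (Opens.comap v)) p.2

theorem copair_fst (f : FrameHom (Opens X) L) (g : FrameHom (Opens Y) L) :
    (copair f g).comp (Opens.comap ContinuousMap.fst) = f := by
  refine FrameHom.ext fun V => le_antisymm ?_ ?_
  · refine boxJoin_le f g fun V' W h => ?_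
    by_cases hW : W = ⊥
    · simp [hW]
    obtain ⟨y, hy⟩ := (Opens.ne_bot_iff_nonempty W).1 hW
    exact inf_le_left.trans (OrderHomClass.mono f fun x hx => h (show (x, y) ∈ _ from ⟨hx, hy⟩))
  · have : f V ⊓ g ⊤ ≤ boxJoin f g (Opens.comap ContinuousMap.fst V) :=
      le_boxJoin f g fun p hp => hp.1
    rwa [map_top, inf_top_eq] at this

theorem copair_snd (f : FrameHom (Opens X) L) (g : FrameHom (Opens Y) L) :
    (copair f g).comp (Opens.comap ContinuousMap.snd) = g := by
  refine FrameHom.ext fun V => le_antisymm ?_ ?_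
  · refine boxJoin_le f g fun V' W h => ?_
    by_cases hV : V' = ⊥
    · simp [hV]
    obtain ⟨x, hx⟩ := (Opens.ne_bot_iff_nonempty V').1 hV
    exact inf_le_right.trans (OrderHomClass.mono g fun y hy => h (show (x, y) ∈ _ from ⟨hx, hy⟩))
  · have : f ⊤ ⊓ g V ≤ boxJoin f g (Opens.comap ContinuousMap.snd V) :=
      le_boxJoin f g fun p hp => hp.2
    rwa [map_top, top_inf_eq] at this

end Copairing

/-! ### The ring of continuous real-valued functions on a frame -/

/-- Continuous real-valued functions on a frame `L`: the frame homomorphisms into `L` from the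
frame of reals, taken to be the frame of open subsets of `ℝ`. -/
def RL (L : Type*) [Order.Frame L] : Type _ := FrameHom (Opens ℝ) L

namespace RL

variable {L : Type*} [Order.Frame L]

/-- The value `α U` in `L` at an open set `U` of reals. -/
def val (α : RL L) (U : Opens ℝ) : L := (show FrameHom (Opens ℝ) L from α) U

/-- The binary operation on `RL L` induced by a continuous operation `F` on `ℝ`:
`(op F α β) U = ⋁ {α V ⊓ β W | F '' (V × W) ⊆ U}`. -/
def op (F : C(ℝ × ℝ, ℝ)) (α β : RL L) : RL L := (copair α β).comp (Opens.comap F)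

theorem op_val (F : C(ℝ × ℝ, ℝ)) (α β : RL L) (U : Opens ℝ) :
    (op F α β).val U = ⨆ (V : Opens ℝ) (W : Opens ℝ)
      (_ : (V : Set ℝ) ×ˢ (W : Set ℝ) ⊆ F ⁻¹' (U : Set ℝ)), α.val V ⊓ β.val W := rfl

open Classical in
/-- The constant function with value `r`: it sends `U` to the top if `r ∈ U`, to the bottom
otherwise. -/
noncomputable def const (L : Type*) [Order.Frame L] (r : ℝ) : RL L where
  toFun U := if r ∈ U then ⊤ else ⊥
  map_top' := by simp
  map_inf' U V := by
    by_cases hU : r ∈ U <;> by_cases hV : r ∈ V <;> simp [hU, hV]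
  map_sSup' S := by
    rw [sSup_image']
    by_cases h : ∃ U ∈ S, r ∈ U
    · obtain ⟨U, hU, hr⟩ := h
      rw [if_pos (Opens.mem_sSup.2 ⟨U, hU, hr⟩)]
      exact (top_le_iff.1 (le_iSup_of_le (⟨U, hU⟩ : S) (by simp [hr]))).symm
    · rw [if_neg (fun hr => h (Opens.mem_sSup.1 hr))]
      push Not at h
      exact (le_bot_iff.1 (iSup_le fun U => by simp [h U U.2])).symm

noncomputable instance : Zero (RL L) := ⟨const L 0⟩
noncomputable instance : One (RL L) := ⟨const L 1⟩
instance : Add (RL L) := ⟨op ⟨fun p => p.1 + p.2, by fun_prop⟩⟩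
instance : Mul (RL L) := ⟨op ⟨fun p => p.1 * p.2, by fun_prop⟩⟩
/-- Negation: `(-α) U = α {x | -x ∈ U}`. -/
instance : Neg (RL L) :=
  ⟨fun α => FrameHom.comp (show FrameHom (Opens ℝ) L from α) (Opens.comap ⟨fun x => -x, by fun_prop⟩)⟩

section Pull

variable {Z : Type*} [TopologicalSpace Z] (T : FrameHom (Opens Z) L)

/-- A continuous function on a space `Z`, seen on `L` along a frame homomorphism from the frame of
opens of `Z`. -/
def pull (u : C(Z, ℝ)) : RL L := T.comp (Opens.comap u)

theorem pull_add (u v : C(Z, ℝ)) : pull T u + pull T v = pull T (u + v) :=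
  congrArg (fun h : FrameHom (Opens (ℝ × ℝ)) L => h.comp
    (Opens.comap ⟨fun p : ℝ × ℝ => p.1 + p.2, by fun_prop⟩)) (copair_comap T u v)

theorem pull_mul (u v : C(Z, ℝ)) : pull T u * pull T v = pull T (u * v) :=
  congrArg (fun h : FrameHom (Opens (ℝ × ℝ)) L => h.comp
    (Opens.comap ⟨fun p : ℝ × ℝ => p.1 * p.2, by fun_prop⟩)) (copair_comap T u v)

theorem pull_neg (u : C(Z, ℝ)) : -pull T u = pull T (-u) := rfl

theorem pull_const (r : ℝ) : pull T (ContinuousMap.const Z r) = const L r := by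
  refine FrameHom.ext fun U => ?_
  classical
  change T (Opens.comap (ContinuousMap.const Z r) U) = if r ∈ U then ⊤ else ⊥
  split_ifs with h
  · rw [← map_top T]; congr 1; ext z; simp [h]
  · rw [← map_bot T]; congr 1; ext z; simp [h]

theorem pull_zero : pull T 0 = 0 := pull_const T 0

theorem pull_one : pull T 1 = 1 := pull_const T 1

end Pull

theorem exists_pull (α β γ : RL L) : ∃ (T : FrameHom (Opens (ℝ × ℝ × ℝ)) L)
    (u v w : C(ℝ × ℝ × ℝ, ℝ)), α = pull T u ∧ β = pull T v ∧ γ = pull T w := by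
  refine ⟨copair α (copair β γ), ContinuousMap.fst, ContinuousMap.fst.comp ContinuousMap.snd,
    ContinuousMap.snd.comp ContinuousMap.snd, (copair_fst α (copair β γ)).symm, ?_, ?_⟩
  · have h := congrArg (fun h : FrameHom (Opens (ℝ × ℝ)) L => h.comp
      (Opens.comap ContinuousMap.fst)) (copair_snd α (copair β γ))
    exact (h.trans (copair_fst β γ)).symm
  · have h := congrArg (fun h : FrameHom (Opens (ℝ × ℝ)) L => h.comp
      (Opens.comap ContinuousMap.snd)) (copair_snd α (copair β γ))
    exact (h.trans (copair_snd β γ)).symm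

/-- The ring structure on `RL L`, with the operations induced by those of `ℝ`. -/
noncomputable instance : CommRing (RL L) where
  add_assoc a b c := by
    obtain ⟨T, u, v, w, rfl, rfl, rfl⟩ := exists_pull a b c
    simp only [pull_add, add_assoc]
  zero_add a := by
    obtain ⟨T, u, v, w, rfl, -, -⟩ := exists_pull a a a
    rw [← pull_zero T, pull_add, zero_add]
  add_zero a := by
    obtain ⟨T, u, v, w, rfl, -, -⟩ := exists_pull a a a
    rw [← pull_zero T, pull_add, add_zero]
  add_comm a b := by
    obtain ⟨T, u, v, w, rfl, rfl, -⟩ := exists_pull a b b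
    rw [pull_add, pull_add, add_comm]
  left_distrib a b c := by
    obtain ⟨T, u, v, w, rfl, rfl, rfl⟩ := exists_pull a b c
    simp only [pull_add, pull_mul, mul_add]
  right_distrib a b c := by
    obtain ⟨T, u, v, w, rfl, rfl, rfl⟩ := exists_pull a b c
    simp only [pull_add, pull_mul, add_mul]
  zero_mul a := by
    obtain ⟨T, u, v, w, rfl, -, -⟩ := exists_pull a a a
    rw [← pull_zero T, pull_mul, zero_mul]
  mul_zero a := by
    obtain ⟨T, u, v, w, rfl, -, -⟩ := exists_pull a a a
    rw [← pull_zero T, pull_mul, mul_zero]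
  mul_assoc a b c := by
    obtain ⟨T, u, v, w, rfl, rfl, rfl⟩ := exists_pull a b c
    simp only [pull_mul, mul_assoc]
  one_mul a := by
    obtain ⟨T, u, v, w, rfl, -, -⟩ := exists_pull a a a
    rw [← pull_one T, pull_mul, one_mul]
  mul_one a := by
    obtain ⟨T, u, v, w, rfl, -, -⟩ := exists_pull a a a
    rw [← pull_one T, pull_mul, mul_one]
  mul_comm a b := by
    obtain ⟨T, u, v, w, rfl, rfl, -⟩ := exists_pull a b b
    rw [pull_mul, pull_mul, mul_comm]
  neg_add_cancel a := by
    obtain ⟨T, u, v, w, rfl, -, -⟩ := exists_pull a a a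
    rw [pull_neg, pull_add, neg_add_cancel, pull_zero]
  nsmul := nsmulRec
  zsmul := zsmulRec

/-- The cozero element `α (-,0) ⊔ α (0,-)`. -/
def coz (α : RL L) : L := α.val ⟨Iio 0, isOpen_Iio⟩ ⊔ α.val ⟨Ioi 0, isOpen_Ioi⟩

theorem coz_pull {Z : Type*} [TopologicalSpace Z] (T : FrameHom (Opens Z) L) (u : C(Z, ℝ)) :
    (pull T u).coz = T (Opens.comap u ⟨{0}ᶜ, isOpen_compl_singleton⟩) := by
  change T (Opens.comap u _) ⊔ T (Opens.comap u _) = _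
  rw [← map_sup]
  congr 1
  ext z
  simp

theorem coz_zero : (0 : RL L).coz = ⊥ := by
  have h : ∀ U : Opens ℝ, (0 : ℝ) ∉ U → (0 : RL L).val U = ⊥ := fun U hU => if_neg hU
  rw [coz, h _ (lt_irrefl (0 : ℝ)), h _ (lt_irrefl (0 : ℝ)), sup_bot_eq]

theorem coz_add_le (α β : RL L) : (α + β).coz ≤ α.coz ⊔ β.coz := by
  obtain ⟨T, u, v, w, rfl, rfl, -⟩ := exists_pull α β β
  rw [pull_add, coz_pull, coz_pull, coz_pull, ← map_sup]
  refine OrderHomClass.mono T fun z hz => ?_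
  by_contra h
  apply hz
  have h' : u z = 0 ∧ v z = 0 := by simpa [not_or] using h
  simp [h'.1, h'.2]

theorem coz_mul_le (α β : RL L) : (α * β).coz ≤ β.coz := by
  obtain ⟨T, u, v, w, rfl, rfl, -⟩ := exists_pull α β β
  rw [pull_mul, coz_pull, coz_pull]
  refine OrderHomClass.mono T fun z hz h => hz ?_
  have h' : v z = 0 := h
  simp [h']

/-- The pointfree image `R_α`: the reals `r` with `coz (α - r) ≠ 1`. -/
def image (α : RL L) : Set ℝ := {r | (α - const L r).coz ≠ ⊤}

end RL

/-! ### The ring `R_c L` and its fixed ideals -/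

/-- The ring `R_c L` of the functions with countable pointfree image, as the subring of `RL L`
that they generate. It consists of these functions alone as soon as they form a subring
(see `mem_Rc_iff`). -/
noncomputable def Rc (L : Type*) [Order.Frame L] : Subring (RL L) :=
  Subring.closure {α : RL L | α.image.Countable}

/-- If the functions with countable pointfree image form a subring of `RL L`, then `Rc L` is that
subring. -/
theorem mem_Rc_iff {L : Type*} [Order.Frame L]
    (h : ∃ A : Subring (RL L), (A : Set (RL L)) = {α : RL L | α.image.Countable}) (α : RL L) :
    α ∈ Rc L ↔ α.image.Countable := by
  obtain ⟨A, hA⟩ := h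
  rw [Rc, ← hA, Subring.closure_eq, ← SetLike.mem_coe, hA, mem_ofPred_eq]

/-- A frame is zero-dimensional if every element is the join of the complemented elements
below it. -/
def IsZeroDimensional (L : Type*) [Order.Frame L] : Prop :=
  ∀ a : L, a = sSup {x : L | x ⊔ xᶜ = ⊤ ∧ x ≤ a}

/-- An ideal `Q` of `R_c L` is fixed if the join of the cozero elements of its members is not
the top. -/
def IsFixed {L : Type*} [Order.Frame L] (Q : Ideal (Rc L)) : Prop :=
  (⨆ α ∈ Q, (α : RL L).coz) < ⊤

/-- The ideal `M_{ca}` of all `α` in `R_c L` with `coz α ≤ a`. -/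
noncomputable def Mc {L : Type*} [Order.Frame L] (a : L) : Ideal (Rc L) where
  carrier := {α | (α : RL L).coz ≤ a}
  zero_mem' := RL.coz_zero.trans_le bot_le
  add_mem' hα hβ := (RL.coz_add_le _ _).trans (sup_le hα hβ)
  smul_mem' _ _ hα := (RL.coz_mul_le _ _).trans hα

end PointfreeReals

namespace PointfreeReals

open TopologicalSpace Set

/-! ### Cozero elements, images, characteristic functions and values at points in `RL L`. -/

namespace RL

variable {L : Type*} [Order.Frame L]

/-! A point `p` evaluates functions: for each `α` the opens `U` with `α U ≤ p` have a largest
member, which is prime, and since `ℝ` is Hausdorff it is the complement of a single real `r`, the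
value of `α` at `p` (`exists_coz_sub_const_le`). So `Mc p` consists of the functions vanishing at
`p`, and it is maximal because the real constants lie in `Rc L`.

Conversely, let `Q` be fixed and maximal, and let `a < ⊤` be the join of its cozero elements. Then
`Q ≤ Mc a`, which is proper because `coz 1 = ⊤`, so `Q = Mc a`. Zero-dimensionality now makes `a` a
point: a complemented element is the cozero element of its characteristic function, which has at
most two values and so lies in `Rc L`. There are thus enough functions for primeness of `Mc a` to
pass to `a` (`infPrime_of_isPrime_Mc`), and for `Mc a` to determine `a` (`le_of_Mc_le`).

Of `Rc L`, only the membership of constants and characteristic functions is used. -/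

theorem pull_sub {Z : Type*} [TopologicalSpace Z] (T : FrameHom (Opens Z) L) (u v : C(Z, ℝ)) :
    pull T u - pull T v = pull T (u - v) := by
  rw [sub_eq_add_neg, pull_neg, pull_add, ← sub_eq_add_neg]

theorem coz_pull_sub_const {Z : Type*} [TopologicalSpace Z] (T : FrameHom (Opens Z) L)
    (u : C(Z, ℝ)) (r : ℝ) :
    (pull T u - const L r).coz = T (Opens.comap u ⟨{r}ᶜ, isOpen_compl_singleton⟩) := by
  rw [← pull_const T, pull_sub, coz_pull]
  congr 1
  ext z
  simp [sub_eq_zero]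

theorem coz_sub_const (α : RL L) (r : ℝ) :
    (α - const L r).coz = α.val ⟨{r}ᶜ, isOpen_compl_singleton⟩ :=
  coz_pull_sub_const (show FrameHom (Opens ℝ) L from α) (ContinuousMap.id ℝ) r

/-- If `u` omits `r`, the preimage of `{r}ᶜ` is the whole space. Countability of images is always
obtained from this bound. -/
theorem image_pull_subset {Z : Type*} [TopologicalSpace Z] (T : FrameHom (Opens Z) L)
    (u : C(Z, ℝ)) : (pull T u).image ⊆ range u := by
  intro r hr
  by_contra h
  refine hr ?_
  rw [coz_pull_sub_const, ← map_top T]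
  congr 1
  ext z
  simpa using fun hz : u z = r => h ⟨z, hz⟩

theorem image_const_countable (r : ℝ) : (const L r).image.Countable := by
  rw [← pull_const (show FrameHom (Opens ℝ) L from const L 0) r]
  refine (countable_singleton r).mono ?_
  rintro x hx
  obtain ⟨y, rfl⟩ := image_pull_subset _ _ hx
  rfl

theorem const_mul_const (r s : ℝ) : const L r * const L s = const L (r * s) := by
  -- Constants are pullbacks along any frame homomorphism, so which `T` is chosen is irrelevant.
  have T : FrameHom (Opens ℝ) L := const L 0
  rw [← pull_const T, ← pull_const T, ← pull_const T, pull_mul]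
  rfl

theorem coz_one : (1 : RL L).coz = ⊤ := by
  have T : FrameHom (Opens ℝ) L := const L 0
  rw [← pull_one T, coz_pull, ← map_top T]
  congr 1
  ext z
  simp

theorem coz_mul (α β : RL L) : (α * β).coz = α.coz ⊓ β.coz := by
  obtain ⟨T, u, v, w, rfl, rfl, -⟩ := exists_pull α β β
  rw [pull_mul, coz_pull, coz_pull, coz_pull, ← map_inf]
  congr 1
  ext z
  simp

/-- The frame homomorphism from the opens of the two-point discrete space determined by a
complemented element. -/
def boolHom (a : L) (ha : a ⊔ aᶜ = ⊤) : FrameHom (Opens Bool) L where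
  -- With joins over propositions, preservation of suprema is an exchange of joins.
  toFun U := (⨆ _ : true ∈ U, a) ⊔ ⨆ _ : false ∈ U, aᶜ
  map_top' := by simpa using ha
  map_inf' U V := by
    by_cases h₁ : true ∈ U <;> by_cases h₂ : true ∈ V <;> by_cases h₃ : false ∈ U <;>
      by_cases h₄ : false ∈ V <;> simp [h₁, h₂, h₃, h₄, ha]
  map_sSup' S := by
    simp only [Opens.mem_sSup, sSup_image, iSup_sup_eq, iSup_exists, iSup_and]

/-- The characteristic function of a complemented element. -/
noncomputable def indicator (a : L) (ha : a ⊔ aᶜ = ⊤) : RL L :=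
  pull (boolHom a ha) ⟨fun b => if b then 1 else 0, continuous_of_discreteTopology⟩

theorem coz_indicator (a : L) (ha : a ⊔ aᶜ = ⊤) : (indicator a ha).coz = a := by
  rw [indicator, coz_pull]
  change (⨆ _ : _, a) ⊔ (⨆ _ : _, aᶜ) = a
  simp [← SetLike.mem_coe]

theorem image_indicator_countable (a : L) (ha : a ⊔ aᶜ = ⊤) :
    (indicator a ha).image.Countable :=
  (countable_range _).mono (image_pull_subset _ _)

/-- At a point of the frame every function takes a real value. -/
theorem exists_coz_sub_const_le {p : L} (hp : InfPrime p) (α : RL L) :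
    ∃ r : ℝ, (α - const L r).coz ≤ p := by
  let f : FrameHom (Opens ℝ) L := α
  -- The largest open set sent below `p`; the value sought is a real outside it.
  let V : Opens ℝ := sSup {U | f U ≤ p}
  have hV : f V ≤ p := by
    rw [map_sSup]
    exact sSup_le (by rintro _ ⟨U, hU, rfl⟩; exact hU)
  have hVtop : ∃ r, r ∉ V := by
    by_contra! h
    have hVt : V = ⊤ := by ext x; simpa using h x
    rw [hVt, map_top] at hV
    exact hp.1 fun _ _ => le_top.trans hV
  obtain ⟨r, hr⟩ := hVtop
  refine ⟨r, ?_⟩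
  rw [coz_sub_const]
  refine le_trans (OrderHomClass.mono f ?_) hV
  intro s hs
  -- Disjoint neighbourhoods have images meeting in `⊥ ≤ p`, so one of them lies in `V`. It cannot
  -- be `B`, which contains `r`; hence `s ∈ V`, and so `{r}ᶜ ≤ V`.
  obtain ⟨A, B, hA, hB, hsA, hrB, hAB⟩ := t2_separation (show s ≠ r from hs)
  have hbot : f ⟨A, hA⟩ ⊓ f ⟨B, hB⟩ ≤ p := by
    rw [← map_inf]
    have : (⟨A, hA⟩ ⊓ ⟨B, hB⟩ : Opens ℝ) = ⊥ := by
      ext x; simpa using fun h₁ h₂ => disjoint_left.1 hAB h₁ h₂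
    rw [this, map_bot]
    exact bot_le
  rcases hp.2 hbot with h | h
  · exact Opens.mem_sSup.2 ⟨_, h, hsA⟩
  · exact absurd (Opens.mem_sSup.2 ⟨_, h, hrB⟩) hr

end RL

/-! ### Maximality, primeness and order for the ideals `Mc a`. -/

variable {L : Type*} [Order.Frame L]

theorem mem_Mc {a : L} {α : Rc L} : α ∈ Mc a ↔ (α : RL L).coz ≤ a := Iff.rfl

theorem const_mem_Rc (r : ℝ) : RL.const L r ∈ Rc L :=
  Subring.subset_closure (RL.image_const_countable r)

theorem indicator_mem_Rc (a : L) (ha : a ⊔ aᶜ = ⊤) : RL.indicator a ha ∈ Rc L :=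
  Subring.subset_closure (RL.image_indicator_countable a ha)

theorem one_notMem_Mc {a : L} (ha : a ≠ ⊤) : (1 : Rc L) ∉ Mc a := fun h =>
  ha (top_le_iff.1 (RL.coz_one.symm.trans_le h))

/-- A function `x` outside `Mc p` has a nonzero value `r` at `p`. An ideal containing `x` and `Mc p`
contains `x - r`, hence the invertible constant `r`. -/
theorem isMaximal_Mc {p : L} (hp : InfPrime p) : (Mc p).IsMaximal := by
  refine Ideal.isMaximal_iff.2 ⟨one_notMem_Mc hp.ne_top, fun J x hJ hx hxJ => ?_⟩
  obtain ⟨r, hr⟩ := RL.exists_coz_sub_const_le hp (x : RL L)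
  have hr0 : r ≠ 0 := by
    rintro rfl
    have h0 : RL.const L 0 = 0 := rfl
    rw [h0, sub_zero] at hr
    exact hx hr
  let c : Rc L := ⟨RL.const L r, const_mem_Rc r⟩
  let d : Rc L := ⟨RL.const L r⁻¹, const_mem_Rc r⁻¹⟩
  have hdc : d * c = 1 := by
    refine Subtype.ext ((RL.const_mul_const r⁻¹ r).trans ?_)
    rw [inv_mul_cancel₀ hr0]
    rfl
  have hxc : x - c ∈ J := hJ hr
  have h1 : (1 : Rc L) = d * x - d * (x - c) := by rw [← hdc]; ring
  rw [h1]
  exact J.sub_mem (J.mul_mem_left d hxJ) (J.mul_mem_left d hxc)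

theorem iSup_coz_Mc_le (a : L) : ⨆ α ∈ Mc a, (α : RL L).coz ≤ a :=
  iSup₂_le fun _ h => h

theorem IsZeroDimensional.le_of_forall (hL : IsZeroDimensional L) {a b : L}
    (h : ∀ x : L, x ⊔ xᶜ = ⊤ → x ≤ a → x ≤ b) : a ≤ b :=
  (hL a).trans_le (sSup_le fun x hx => h x hx.1 hx.2)

/-- It suffices to test complemented `u ≤ x` and `v ≤ y`. The product of their characteristic
functions has cozero element `u ⊓ v ≤ a`, so one factor lies in `Mc a`. -/
theorem infPrime_of_isPrime_Mc (hL : IsZeroDimensional L) {a : L} (h : (Mc a).IsPrime) :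
    InfPrime a := by
  refine ⟨fun ha => h.ne_top ((Ideal.eq_top_iff_one _).2 (mem_Mc.2 ?_)), fun x y hxy => ?_⟩
  · exact le_top.trans (ha le_top)
  by_contra! hn
  refine hn.1 (hL.le_of_forall fun u hu hux => ?_)
  by_contra hua
  refine hn.2 (hL.le_of_forall fun v hv hvy => ?_)
  let α : Rc L := ⟨RL.indicator u hu, indicator_mem_Rc u hu⟩
  let β : Rc L := ⟨RL.indicator v hv, indicator_mem_Rc v hv⟩
  have hm : α * β ∈ Mc a := by
    rw [mem_Mc]
    refine (RL.coz_mul _ _).trans_le ?_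
    rw [RL.coz_indicator, RL.coz_indicator]
    exact (inf_le_inf hux hvy).trans hxy
  rcases h.mem_or_mem hm with h' | h'
  · exact absurd ((RL.coz_indicator u hu).symm.trans_le h') hua
  · exact (RL.coz_indicator v hv).symm.trans_le h'

/-- The complemented elements below `a` have join `a`, and each is the cozero element of a member of
`Mc a`. -/
theorem le_of_Mc_le (hL : IsZeroDimensional L) {a b : L} (h : Mc a ≤ Mc b) : a ≤ b := by
  refine hL.le_of_forall fun u hu hua => ?_
  have hm : (⟨RL.indicator u hu, indicator_mem_Rc u hu⟩ : Rc L) ∈ Mc a :=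
    (RL.coz_indicator u hu).trans_le hua
  exact (RL.coz_indicator u hu).symm.trans_le (h hm)

end PointfreeReals

theorem theorem6p5 {L : Type*} [Order.Frame L] (hL : PointfreeReals.IsZeroDimensional L) :
    (∀ Q : Ideal (PointfreeReals.Rc L),
      (Q.IsMaximal ∧ PointfreeReals.IsFixed Q) ↔
        ∃ p : L, InfPrime p ∧ Q = PointfreeReals.Mc p) ∧
    (∀ p q : L, InfPrime p → InfPrime q →
      PointfreeReals.Mc p = PointfreeReals.Mc q → p = q) := by
  open PointfreeReals in
  refine ⟨fun Q => ⟨?_, ?_⟩, fun p q _ _ h =>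
    le_antisymm (le_of_Mc_le hL h.le) (le_of_Mc_le hL h.ge)⟩
  · rintro ⟨hQ, hfix⟩
    have hle : Q ≤ Mc (⨆ α ∈ Q, (α : RL L).coz) := fun α hα =>
      le_iSup₂ (f := fun (α : Rc L) (_ : α ∈ Q) => (α : RL L).coz) α hα
    have hne : Mc (⨆ α ∈ Q, (α : RL L).coz) ≠ ⊤ := fun h =>
      one_notMem_Mc hfix.ne (h ▸ Submodule.mem_top)
    have hEq := hQ.eq_of_le hne hle
    exact ⟨_, infPrime_of_isPrime_Mc hL (hEq ▸ hQ.isPrime), hEq⟩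
  · rintro ⟨p, hp, rfl⟩
    exact ⟨isMaximal_Mc hp, (iSup_coz_Mc_le p).trans_lt hp.ne_top.lt_top⟩
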